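/- Let $(R,\mathfrak m)$ be a Noetherian local ring of Krull dimension $d$. The generalized Loewy length $\mathrm{g}\ell\ell(R)$ is the smallest integer $k\ge 1$ such that $\mathfrak m^{k}\subseteq (x_1,\dots,x_d)$ for some system of parameters $x_1,\dots,x_d$ of $R$. If $R$ is Cohen–Macaulay and $M$ is a finitely generated $R$-module, $\delta_R(M)$ denotes the smallest integer $k\ge 0$ for which there is a surjective $R$-linear map $X\oplus R^{k}\to M$, where $X$ is zero or a maximal Cohen–Macaulay $R$-module with no nonzero free direct summand, and $\mathrm{index}(R)=\inf\{k\ge 1 : \delta_R(R/\mathfrak m^{k})=1\}$. **Proposition.** Let $m,n\ge 0$ be integers and let $p>3$ be a prime such that $2$ is a primitive root modulo $p^2$. Let $$R=\mathbb F_2[[x,y]]/\bigl(xy(x^{2^n p^m}+y^{2^n p^m})\bigr)$$ and let $\mathfrak m=(x,y)R$ be its maximal ideal. Then $$\mathrm{g}\ell\ell(R)=\mathrm{index}(R)+1=2^n p^m+3\qquad\text{and}\qquad \mathfrak m^{2^n p^m+3}\subseteq (x^2+xy+y^2)R.$$ If $m=1$, it suffices to assume, instead of the condition modulo $p^2$,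 that $2$ is a primitive root modulo $p$. -/

import Mathlib

universe u v

namespace LoewyIndex

section Invariants

variable (R : Type u) [CommRing R] [IsLocalRing R]

/-- A maximal Cohen-Macaulay module over the (Noetherian) local ring `R`: a finitely generated
module which has a regular sequence of length `dim R` consisting of elements of the maximal ideal.
(`RingTheory.Sequence.IsRegular` forces the module to be nonzero.) -/
def IsMaximalCM (X : Type v) [AddCommGroup X] [Module R X] : Prop :=
  Module.Finite R X ∧ ∃ rs : List R,
    ringKrullDim R = (rs.length : WithBot ℕ∞) ∧
    (∀ r ∈ rs, r ∈ IsLocalRing.maximalIdeal R) ∧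
    RingTheory.Sequence.IsRegular X rs

/-- `X` has no nonzero free direct summand. -/
def NoFreeSummand (X : Type v) [AddCommGroup X] [Module R X] : Prop :=
  ∀ N P : Submodule R X, IsCompl N P → Module.Free R N → N = ⊥

/-- Auslander's `δ`-invariant of a finitely generated `R`-module `M`: the least `n` such that there
is a surjection `X ⊕ R ^ n → M` with `X` maximal Cohen-Macaulay without free direct summand
(`X = 0` is allowed, so that the set below is nonempty when `M` is finitely generated). -/
noncomputable def delta (M : Type v) [AddCommGroup M] [Module R M] : ℕ :=
  sInf {n : ℕ | ∃ (X : Type u) (_ : AddCommGroup X) (_ : Module R X),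
    (Subsingleton X ∨ IsMaximalCM R X) ∧ NoFreeSummand R X ∧
    ∃ φ : (X × (Fin n → R)) →ₗ[R] M, Function.Surjective φ}

/-- `index R = inf {n ≥ 1 | δ (R / 𝔪 ^ n) = 1}`, with value `⊤` if there is no such `n`. -/
noncomputable def index : ℕ∞ :=
  sInf {k : ℕ∞ | ∃ n : ℕ, k = n ∧ 1 ≤ n ∧ delta R (R ⧸ IsLocalRing.maximalIdeal R ^ n) = 1}

/-- `x₁, …, x_d` is a system of parameters of the local ring `R`: `d = dim R` and the ideal
`(x₁, …, x_d)` is primary to the maximal ideal. -/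
def IsSystemOfParameters {d : ℕ} (x : Fin d → R) : Prop :=
  ringKrullDim R = (d : WithBot ℕ∞) ∧
    (Ideal.span (Set.range x)).radical = IsLocalRing.maximalIdeal R

/-- The generalized Loewy length of `R`: the least `n ≥ 1` such that `𝔪 ^ n` is contained in the
ideal generated by some system of parameters (`⊤` if there is no such `n`). -/
noncomputable def gll : ℕ∞ :=
  sInf {k : ℕ∞ | ∃ n : ℕ, k = n ∧ 1 ≤ n ∧ ∃ (d : ℕ) (x : Fin d → R),
    IsSystemOfParameters R x ∧ IsLocalRing.maximalIdeal R ^ n ≤ Ideal.span (Set.range x)}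

end Invariants

/-- For `n ≥ 1`, the integer `g` is a primitive root modulo `n`: its multiplicative order modulo
`n` is `φ(n)`. -/
def IsPrimitiveRootMod (g n : ℕ) : Prop :=
  orderOf (g : ZMod n) = Nat.totient n

/-- The power series `xy(x ^ N + y ^ N)` in `𝔽₂⟦x, y⟧`. -/
noncomputable def hypersurfaceEq (N : ℕ) : MvPowerSeries (Fin 2) (ZMod 2) :=
  MvPowerSeries.X 0 * MvPowerSeries.X 1 * (MvPowerSeries.X 0 ^ N + MvPowerSeries.X 1 ^ N)

/-- The ring `𝔽₂⟦x, y⟧ / (xy(x ^ N + y ^ N))`. -/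
abbrev HypersurfaceRing (N : ℕ) : Type :=
  MvPowerSeries (Fin 2) (ZMod 2) ⧸ Ideal.span {hypersurfaceEq N}

instance instIsLocalRingHypersurfaceRing (N : ℕ) : IsLocalRing (HypersurfaceRing N) := by
  have hne : Ideal.span {hypersurfaceEq N} ≠ ⊤ := by
    rw [Ne, Ideal.span_singleton_eq_top]
    intro h
    have h1 := h.map (MvPowerSeries.constantCoeff (σ := Fin 2) (R := ZMod 2))
    simp [hypersurfaceEq] at h1
  have : Nontrivial (HypersurfaceRing N) := Ideal.Quotient.nontrivial_iff.mpr hne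
  exact IsLocalRing.of_surjective' (Ideal.Quotient.mk _) Ideal.Quotient.mk_surjective

/-- The image of `x` in `𝔽₂⟦x, y⟧ / (xy(x ^ N + y ^ N))`. -/
noncomputable def xbar (N : ℕ) : HypersurfaceRing N :=
  Ideal.Quotient.mk _ (MvPowerSeries.X 0)

/-- The image of `y` in `𝔽₂⟦x, y⟧ / (xy(x ^ N + y ^ N))`. -/
noncomputable def ybar (N : ℕ) : HypersurfaceRing N :=
  Ideal.Quotient.mk _ (MvPowerSeries.X 1)

end LoewyIndex

/-!
Write `N = 2 ^ n p ^ m`, `S = 𝔽₂⟦x, y⟧` with maximal ideal `𝔫`, `f = xy(x ^ N + y ^ N)` and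
`R = S ⧸ (f)` with maximal ideal `𝔪`. The power series `f` has order `N + 2`, and `N` is not
divisible by `3`.

*The inclusion.* Modulo `u = x ^ 2 + xy + y ^ 2` one has `x ^ 3 = y ^ 3`, and as `3 ∤ N` the image
of `f` is, up to sign, `y ^ (N + 2)` or `y ^ (N + 1) (x + y)`. This kills all monomials of degree
`N + 3` (`mul_pow_eq_zero_and_pow_eq_zero`), so `𝔪 ^ (N + 3) ⊆ (u)`. Hence `𝔪` is minimal over the
principal ideal `(u)`, the ring `R` is one-dimensional and `u` is a parameter.

*The generalized Loewy length is not smaller.* Let `𝔫 ^ (N + 2) ⊆ (z, f)` with `z ∈ 𝔫`. Then `f` is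
a nonzerodivisor modulo `z`. Every nonzero linear form `l` over `𝔽₂` divides `f`, say `f = l g` with
`g ∈ 𝔫 ^ (N + 1)`, and cancelling `g` from `𝔫 g ⊆ 𝔫 ^ (N + 2) ⊆ (z, l g)` gives `𝔫 = (l, z)`. So the
linear part of `z` is independent of each of `x`, `y`, `x + y`, which is impossible over `𝔽₂`
(`not_maximalIdeal_pow_le_span_pair`).

*The index is `N + 2`.* For `k ≤ N + 1` the maximal Cohen-Macaulay module `R ⧸ (g) ≅ xR`, where
`g = y(x ^ N + y ^ N) ∈ 𝔪 ^ (N + 1)`, has no free summand, being killed by `g ≠ 0`, and maps onto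
`R ⧸ 𝔪 ^ k`; so `δ(R ⧸ 𝔪 ^ k) = 0`. A maximal Cohen-Macaulay module `X` without free summand has free
first syzygies over `S`, hence comes from a matrix factorization of `f` with entries in `𝔫`; a
surjection from `X` onto `R ⧸ 𝔪 ^ (N + 2) = S ⧸ 𝔫 ^ (N + 2)` would force `f ∈ 𝔫 ^ (N + 3)`
(`mem_maximalIdeal_pow_succ_of_surjective`). So `δ(R ⧸ 𝔪 ^ (N + 2)) = 1`.
-/

namespace LoewyIndex

/-! ### The maximal ideal of a power series ring -/

section PowerSeries

open MvPowerSeries IsLocalRing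

/-- Powers of two distinct variables form a regular sequence. -/
theorem X_pow_dvd_of_X_pow_mul_eq {σ A : Type*} [CommSemiring A] {i j : σ} (hij : i ≠ j)
    {k l : ℕ} {a b : MvPowerSeries σ A}
    (h : (X i : MvPowerSeries σ A) ^ k * a = X j ^ l * b) :
    (X j : MvPowerSeries σ A) ^ l ∣ a := by
  classical
  rw [X_pow_dvd_iff]
  intro m hm
  have h1 := congrArg (coeff (Finsupp.single i k + m)) h
  rw [X_pow_eq i, coeff_add_monomial_mul, one_mul] at h1
  rw [h1]
  refine X_pow_dvd_iff.1 (Dvd.intro b rfl) _ ?_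
  simpa [Finsupp.single_apply, hij] using hm

/-- The Leibniz rule for linear coefficients. -/
theorem coeff_single_one_mul {σ A : Type*} [CommSemiring A] (i : σ)
    (a b : MvPowerSeries σ A) :
    coeff (Finsupp.single i 1) (a * b) =
      constantCoeff a * coeff (Finsupp.single i 1) b +
        coeff (Finsupp.single i 1) a * constantCoeff b := by
  classical
  rw [coeff_mul, Finsupp.antidiagonal_single, Finset.sum_map,
    Finset.Nat.antidiagonal_succ]
  simp

variable {k : Type*} [Field k]

theorem mem_maximalIdeal_iff {σ : Type*} {a : MvPowerSeries σ k} :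
    a ∈ maximalIdeal (MvPowerSeries σ k) ↔ constantCoeff a = 0 := by
  rw [mem_maximalIdeal, mem_nonunits_iff, MvPowerSeries.isUnit_iff_constantCoeff, isUnit_iff_ne_zero,
    not_not]

theorem X_mem_maximalIdeal {σ : Type*} (i : σ) : (X i : MvPowerSeries σ k) ∈
    maximalIdeal (MvPowerSeries σ k) :=
  mem_maximalIdeal_iff.2 (constantCoeff_X i)

theorem maximalIdeal_eq_span_X :
    maximalIdeal (MvPowerSeries (Fin 2) k) = Ideal.span {X 0, X 1} := by
  apply le_antisymm
  · intro a ha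
    rw [mem_maximalIdeal_iff] at ha
    -- The terms of `a` which do not involve `X 0`.
    let b : MvPowerSeries (Fin 2) k := fun m => if m 0 = 0 then coeff m a else 0
    have hb (m : Fin 2 →₀ ℕ) : coeff m b = if m 0 = 0 then coeff m a else 0 := rfl
    have h1 : (X 1 : MvPowerSeries (Fin 2) k) ∣ b := by
      rw [X_dvd_iff]
      intro m hm
      rw [hb]
      split_ifs with h0
      · have : m = 0 := by
          ext i
          fin_cases i <;> simp [h0, hm]
        rw [this]
        exact ha
      · rfl
    have h0 : (X 0 : MvPowerSeries (Fin 2) k) ∣ a - b := by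
      rw [X_dvd_iff]
      intro m hm
      rw [map_sub, hb, if_pos hm, sub_self]
    rw [← sub_add_cancel a b]
    exact Ideal.add_mem _ (Ideal.mem_of_dvd _ h0 (Ideal.subset_span (by simp)))
      (Ideal.mem_of_dvd _ h1 (Ideal.subset_span (by simp)))
  · rw [Ideal.span_le]
    rintro _ (rfl | rfl) <;> exact X_mem_maximalIdeal _

theorem le_order_of_mem_maximalIdeal_pow {σ : Type*} {n : ℕ} {a : MvPowerSeries σ k}
    (ha : a ∈ maximalIdeal (MvPowerSeries σ k) ^ n) : (n : ℕ∞) ≤ a.order := by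
  induction n generalizing a with
  | zero => simp
  | succ n ih =>
    rw [pow_succ'] at ha
    refine Submodule.mul_induction_on ha (fun b hb c hc => ?_) fun b c hb hc => ?_
    · have h1 : 1 ≤ b.order := one_le_order_iff_constCoeff_eq_zero.2 (mem_maximalIdeal_iff.1 hb)
      rw [Nat.cast_succ, add_comm]
      exact (add_le_add h1 (ih hc)).trans le_order_mul
    · exact (le_min hb hc).trans min_order_le_add

end PowerSeries

/-! ### Modules of positive depth over a hypersurface in a two-dimensional regular ring -/

section Syzygies
open IsLocalRing TensorProduct

/-- Over a Noetherian local ring with maximal ideal `(x, y)`, let `X` have no nonzero element killed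
by `x` and `y`. Then the first syzygies of `X` inside a module `F` on which the Koszul complex of
`x, y` is exact in degree one are free: by exactness, `x ⊗ a + y ⊗ b` maps to zero in the kernel
`K` of `π` only if `a = y c` and `b = -x c`, and the socle condition puts `c` in `K`; so
`𝔪 ⊗ K → K` is injective. -/
theorem free_ker_of_socle_eq_bot {S : Type*} [CommRing S] [IsLocalRing S] [IsNoetherianRing S]
    {x y : S} (hm : maximalIdeal S = Ideal.span {x, y})
    {F X : Type*} [AddCommGroup F] [Module S F] [Module.Finite S F] [AddCommGroup X] [Module S X]
    (hreg : ∀ a b : F, x • a + y • b = 0 → ∃ c : F, a = y • c ∧ b = -(x • c))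
    (π : F →ₗ[S] X) (hX : ∀ ξ : X, x • ξ = 0 → y • ξ = 0 → ξ = 0) :
    Module.Free S (LinearMap.ker π) := by
  have hx : x ∈ maximalIdeal S := hm ▸ Ideal.subset_span (by simp)
  have hy : y ∈ maximalIdeal S := hm ▸ Ideal.subset_span (by simp)
  have hfp : Module.FinitePresentation S (LinearMap.ker π) :=
    Module.finitePresentation_of_finite S _
  apply Module.free_of_maximalIdeal_rTensor_injective
  rw [injective_iff_map_eq_zero]
  intro t ht
  obtain ⟨a, b, rfl⟩ : ∃ a b : LinearMap.ker π,
      t = (⟨x, hx⟩ : maximalIdeal S) ⊗ₜ[S] a + (⟨y, hy⟩ : maximalIdeal S) ⊗ₜ[S] b := by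
    clear ht
    induction t with
    | zero => exact ⟨0, 0, by simp⟩
    | tmul s k =>
      obtain ⟨s, hs⟩ := s
      obtain ⟨p, q, hpq⟩ := Ideal.mem_span_pair.1 (hm ▸ hs)
      refine ⟨p • k, q • k, ?_⟩
      rw [← smul_tmul, ← smul_tmul, ← add_tmul]
      congr 1
      exact Subtype.ext hpq.symm
    | add t₁ t₂ h₁ h₂ =>
      obtain ⟨a₁, b₁, rfl⟩ := h₁
      obtain ⟨a₂, b₂, rfl⟩ := h₂
      exact ⟨a₁ + a₂, b₁ + b₂, by rw [tmul_add, tmul_add]; abel⟩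
  have h0 : x • (a : F) + y • (b : F) = 0 := by
    have h1 := congrArg (TensorProduct.lid S (LinearMap.ker π)) ht
    simp only [map_add, LinearMap.rTensor_tmul, Submodule.subtype_apply, TensorProduct.lid_tmul,
      map_zero] at h1
    exact congrArg Subtype.val h1
  obtain ⟨c, hac, hbc⟩ := hreg _ _ h0
  have hc : c ∈ LinearMap.ker π := by
    rw [LinearMap.mem_ker]
    apply hX
    · rw [← map_smul, ← neg_eq_zero, ← map_neg, ← hbc]
      exact b.2
    · rw [← map_smul, ← hac]
      exact a.2
  have ha : a = y • ⟨c, hc⟩ := Subtype.ext hac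
  have hb : b = -(x • ⟨c, hc⟩) := Subtype.ext hbc
  have hxy : y • (⟨x, hx⟩ : maximalIdeal S) + -(x • (⟨y, hy⟩ : maximalIdeal S)) = 0 :=
    Subtype.ext (by simp [mul_comm])
  rw [ha, hb, tmul_neg, ← smul_tmul, ← smul_tmul, ← neg_tmul, ← add_tmul, hxy, zero_tmul]

/-- A surjection onto the ring splits, so its source has a free summand. -/
theorem not_noFreeSummand_of_surjective {R : Type*} [CommRing R] [IsLocalRing R]
    {X : Type*} [AddCommGroup X] [Module R X] (g : X →ₗ[R] R) (hg : Function.Surjective g) :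
    ¬ NoFreeSummand R X := by
  intro hX
  obtain ⟨s, hs⟩ := g.exists_rightInverse_of_surjective (LinearMap.range_eq_top.2 hg)
  have hs' (r : R) : g (s r) = r := LinearMap.congr_fun hs r
  have hinj : Function.Injective s := Function.LeftInverse.injective hs'
  have hcompl : IsCompl (LinearMap.range s) (LinearMap.ker g) := by
    constructor
    · rw [Submodule.disjoint_def]
      rintro _ ⟨r, rfl⟩ hr
      rw [LinearMap.mem_ker, hs'] at hr
      rw [hr, map_zero]
    · rw [codisjoint_iff, eq_top_iff]
      intro v _
      rw [← add_sub_cancel (s (g v)) v]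
      exact Submodule.add_mem_sup ⟨_, rfl⟩ (by simp [hs'])
  have hfree : Module.Free R (LinearMap.range s) :=
    Module.Free.of_equiv (LinearEquiv.ofInjective s hinj)
  have h1 : s 1 ∈ LinearMap.range s := ⟨1, rfl⟩
  rw [hX _ _ hcompl hfree, Submodule.mem_bot] at h1
  exact one_ne_zero (hinj (h1.trans (map_zero s).symm))

/-- Let `X` be a module over `S ⧸ (f)` of positive depth and without free summand, where `S` has
maximal ideal `𝔫 = (x, y)`. If `X` maps onto `S ⧸ 𝔫 ^ e`, then `f ∈ 𝔫 ^ (e + 1)`. In a presentation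
`0 → K → S ^ r → X → 0` the kernel `K` is free; the coordinates in `K` of multiplication by `f` on
`S ^ r` form the other half of a matrix factorization of `f`. These coordinates lie in `𝔫`, since a
unit among them yields a surjection from `X` onto `S ⧸ (f)`. A lift `Φ : S ^ r → S` of the
surjection takes a unit value, and `Φ(K) ⊆ 𝔫 ^ e`, so that `f Φ(v) = Φ(f v) ∈ 𝔫 · 𝔫 ^ e`. -/
theorem mem_maximalIdeal_pow_succ_of_surjective {S : Type*} [CommRing S] [IsLocalRing S]
    [IsNoetherianRing S] {x y f : S} (hm : maximalIdeal S = Ideal.span {x, y})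
    (hreg : ∀ a b : S, x * a + y * b = 0 → ∃ c, a = y * c ∧ b = -(x * c))
    [IsLocalRing (S ⧸ Ideal.span {f})]
    {X : Type*} [AddCommGroup X] [Module S X] [Module (S ⧸ Ideal.span {f}) X]
    [IsScalarTower S (S ⧸ Ideal.span {f}) X] [Module.Finite S X]
    (hX : ∀ ξ : X, x • ξ = 0 → y • ξ = 0 → ξ = 0)
    (hfree : NoFreeSummand (S ⧸ Ideal.span {f}) X) {e : ℕ} (he : e ≠ 0)
    (φ : X →ₗ[S] S ⧸ maximalIdeal S ^ e) (hφ : Function.Surjective φ) :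
    f ∈ maximalIdeal S ^ (e + 1) := by
  obtain ⟨r, π, hπ⟩ := Module.Finite.exists_fin' S X
  have hfX (ξ : X) : f • ξ = 0 := by
    rw [← algebraMap_smul (S ⧸ Ideal.span {f}) f ξ, Ideal.Quotient.algebraMap_eq,
      Ideal.Quotient.eq_zero_iff_mem.2 (Ideal.mem_span_singleton_self f), zero_smul]
  have hK : Module.Free S (LinearMap.ker π) := by
    refine free_ker_of_socle_eq_bot hm (fun a b hab => ?_) π hX
    choose c hc using fun i => hreg (a i) (b i) (congrFun hab i)
    exact ⟨c, funext fun i => (hc i).1, funext fun i => (hc i).2⟩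
  let κ := Module.Free.chooseBasis S (LinearMap.ker π)
  have hfK (v : Fin r → S) : f • v ∈ LinearMap.ker π := by
    rw [LinearMap.mem_ker, map_smul, hfX]
  let B : (Fin r → S) →ₗ[S] LinearMap.ker π :=
    (f • (LinearMap.id : (Fin r → S) →ₗ[S] (Fin r → S))).codRestrict (LinearMap.ker π) hfK
  have hB (v : Fin r → S) : (B v : Fin r → S) = f • v := rfl
  have hcoord (v : Fin r → S) (j) : κ.repr (B v) j ∈ maximalIdeal S := by
    by_contra hu
    rw [mem_maximalIdeal, mem_nonunits_iff, not_not] at hu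
    -- On `K` this coordinate is `f` times a basis coordinate, so it descends to `X → S ⧸ (f)`.
    let ψ : (Fin r → S) →ₗ[S] S := κ.coord j ∘ₗ B
    have hψ : LinearMap.ker π ≤ LinearMap.ker ((Ideal.span {f}).mkQ ∘ₗ ψ) := by
      intro k hk
      have : B k = f • (⟨k, hk⟩ : LinearMap.ker π) := rfl
      simp only [ψ, LinearMap.mem_ker, LinearMap.comp_apply, this, map_smul, Submodule.mkQ_apply,
        smul_eq_mul]
      rw [Submodule.Quotient.mk_eq_zero]
      exact Ideal.mul_mem_right _ _ (Ideal.mem_span_singleton_self f)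
    let g₀ : X →ₗ[S] S ⧸ Ideal.span {f} :=
      (LinearMap.ker π).liftQ _ hψ ∘ₗ (π.quotKerEquivOfSurjective hπ).symm.toLinearMap
    have hg₀ (v : Fin r → S) : g₀ (π v) = Ideal.Quotient.mk _ (ψ v) := by
      have : (π.quotKerEquivOfSurjective hπ).symm (π v) = Submodule.Quotient.mk v := by
        rw [LinearEquiv.symm_apply_eq]
        rfl
      simp only [g₀, LinearMap.comp_apply, LinearEquiv.coe_coe, this]
      rfl
    have hlin (c : S ⧸ Ideal.span {f}) (ξ : X) : g₀ (c • ξ) = c • g₀ ξ := by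
      obtain ⟨c, rfl⟩ := Ideal.Quotient.mk_surjective c
      rw [← Ideal.Quotient.algebraMap_eq, algebraMap_smul, algebraMap_smul, map_smul]
    let g : X →ₗ[S ⧸ Ideal.span {f}] S ⧸ Ideal.span {f} :=
      { toFun := g₀, map_add' := map_add g₀, map_smul' := hlin }
    refine not_noFreeSummand_of_surjective g (fun c => ?_) hfree
    obtain ⟨c, rfl⟩ := Ideal.Quotient.mk_surjective c
    obtain ⟨w, hw⟩ := hu.exists_left_inv
    refine ⟨π ((c * w) • v), ?_⟩
    change g₀ (π ((c * w) • v)) = _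
    rw [hg₀, map_smul]
    congr 1
    change (c * w) * κ.repr (B v) j = c
    rw [mul_assoc, hw, mul_one]
  obtain ⟨Φ, hΦ⟩ := Module.projective_lifting_property (maximalIdeal S ^ e).mkQ (φ ∘ₗ π)
    (Submodule.mkQ_surjective _)
  have hΦ' (v : Fin r → S) : Ideal.Quotient.mk (maximalIdeal S ^ e) (Φ v) = φ (π v) :=
    LinearMap.congr_fun hΦ v
  obtain ⟨ξ, hξ⟩ := hφ 1
  obtain ⟨v, rfl⟩ := hπ ξ
  have hunit : IsUnit (Φ v) := by
    have h1 : Φ v - 1 ∈ maximalIdeal S ^ e := by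
      rw [← Ideal.Quotient.eq, hΦ', hξ, map_one]
    by_contra hu
    have h2 := Ideal.sub_mem _ ((mem_maximalIdeal _).2 hu) (Ideal.pow_le_self he h1)
    rw [sub_sub_cancel] at h2
    exact (mem_maximalIdeal _).1 h2 isUnit_one
  have hmem : f * Φ v ∈ maximalIdeal S ^ (e + 1) := by
    have h1 : f * Φ v = ∑ j, κ.repr (B v) j * Φ (κ j) := by
      rw [← smul_eq_mul, ← map_smul, ← hB]
      have h2 := congrArg (Φ ∘ₗ (LinearMap.ker π).subtype) (κ.sum_repr (B v))
      simpa only [map_sum, map_smul, LinearMap.comp_apply, Submodule.subtype_apply,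
        smul_eq_mul] using h2.symm
    rw [h1, pow_succ']
    refine Ideal.sum_mem _ fun j _ => Ideal.mul_mem_mul (hcoord v j) ?_
    rw [← Ideal.Quotient.eq_zero_iff_mem, hΦ', (κ j).2, map_zero]
  obtain ⟨w, hw⟩ := hunit.exists_right_inv
  have := Ideal.mul_mem_right w _ hmem
  rwa [mul_assoc, hw, mul_one] at this

end Syzygies

/-! ### The power series `xy(x ^ N + y ^ N)` over `𝔽₂` -/

section Hypersurface

open MvPowerSeries IsLocalRing

instance instIsDomainMvPowerSeries {σ A : Type*} [CommRing A] [IsDomain A] :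
    IsDomain (MvPowerSeries σ A) :=
  NoZeroDivisors.to_isDomain _

theorem X_ne_zero {σ A : Type*} [CommSemiring A] [Nontrivial A] (i : σ) :
    (X i : MvPowerSeries σ A) ≠ 0 :=
  nonZeroDivisors.ne_zero X_mem_nonzeroDivisors

/-- The regular local ring `𝔽₂⟦x, y⟧`, with `x = X 0` and `y = X 1`. -/
abbrev PlaneSeries : Type := MvPowerSeries (Fin 2) (ZMod 2)

/-- Exactness of the Koszul complex of `x, y` in degree one. -/
theorem exists_eq_mul_of_X_mul_add_X_mul_eq_zero {k : Type*} [Field k]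
    (a b : MvPowerSeries (Fin 2) k) (h : X 0 * a + X 1 * b = 0) :
    ∃ c, a = X 1 * c ∧ b = -(X 0 * c) := by
  have h1 : X 0 ^ 1 * a = X 1 ^ 1 * -b := by linear_combination h
  obtain ⟨c, hc⟩ := X_pow_dvd_of_X_pow_mul_eq (by decide) h1
  rw [pow_one] at hc
  refine ⟨c, hc, ?_⟩
  apply mul_left_cancel₀ (X_ne_zero (A := k) (1 : Fin 2))
  rw [hc] at h
  linear_combination h

theorem X_pow_add_X_pow_mem (N : ℕ) :
    (X 0 ^ N + X 1 ^ N : PlaneSeries) ∈ maximalIdeal PlaneSeries ^ N :=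
  Ideal.add_mem _ (Ideal.pow_mem_pow (X_mem_maximalIdeal _) N)
    (Ideal.pow_mem_pow (X_mem_maximalIdeal _) N)

theorem X_mul_X_pow_add_X_pow_mem (i : Fin 2) (N : ℕ) :
    (X i * (X 0 ^ N + X 1 ^ N) : PlaneSeries) ∈ maximalIdeal PlaneSeries ^ (N + 1) := by
  rw [pow_succ']
  exact Ideal.mul_mem_mul (X_mem_maximalIdeal _) (X_pow_add_X_pow_mem N)

theorem hypersurfaceEq_eq_X_zero_mul (N : ℕ) :
    hypersurfaceEq N = X 0 * (X 1 * (X 0 ^ N + X 1 ^ N)) := by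
  rw [hypersurfaceEq, mul_assoc]

theorem hypersurfaceEq_eq_X_one_mul (N : ℕ) :
    hypersurfaceEq N = X 1 * (X 0 * (X 0 ^ N + X 1 ^ N)) := by
  rw [hypersurfaceEq]; ring

/-- In characteristic two, `x + y = x - y` divides `x ^ N + y ^ N = x ^ N - y ^ N`. -/
theorem exists_hypersurfaceEq_eq_X_add_X_mul {N : ℕ} (hN : N ≠ 0) :
    ∃ g ∈ maximalIdeal PlaneSeries ^ (N + 1), hypersurfaceEq N = (X 0 + X 1) * g := by
  obtain ⟨N, rfl⟩ : ∃ M, N = M + 1 := Nat.exists_eq_succ_of_ne_zero hN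
  have h2 : (2 : PlaneSeries) = 0 := by
    rw [← map_ofNat (C (σ := Fin 2) (R := ZMod 2)) 2, show (OfNat.ofNat 2 : ZMod 2) = 0 from rfl,
      map_zero]
  refine ⟨X 0 * X 1 * ∑ i ∈ Finset.range (N + 1), X 0 ^ i * X 1 ^ (N + 1 - 1 - i), ?_, ?_⟩
  · rw [show N + 1 + 1 = 1 + 1 + N by omega, pow_add, pow_add, pow_one]
    refine Ideal.mul_mem_mul (Ideal.mul_mem_mul (X_mem_maximalIdeal _) (X_mem_maximalIdeal _))
      (Ideal.sum_mem _ fun i hi => ?_)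
    have hi' : i + (N + 1 - 1 - i) = N := by
      have := Finset.mem_range.1 hi
      omega
    have := Ideal.mul_mem_mul (Ideal.pow_mem_pow (X_mem_maximalIdeal (k := ZMod 2) (0 : Fin 2)) i)
      (Ideal.pow_mem_pow (X_mem_maximalIdeal (1 : Fin 2)) (N + 1 - 1 - i))
    rwa [← pow_add, hi'] at this
  · have h := (Commute.all (X 0 : PlaneSeries) (X 1)).geom_sum₂_mul (N + 1)
    rw [hypersurfaceEq]
    linear_combination (-(X 0 : PlaneSeries) * X 1) * h + (X 0 * X 1 ^ (N + 2) -
      X 0 * X 1 ^ 2 * ∑ i ∈ Finset.range (N + 1), X 0 ^ i * X 1 ^ (N + 1 - 1 - i)) * h2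

theorem hypersurfaceEq_mem (N : ℕ) :
    hypersurfaceEq N ∈ maximalIdeal PlaneSeries ^ (N + 2) := by
  rw [hypersurfaceEq_eq_X_zero_mul, pow_succ']
  exact Ideal.mul_mem_mul (X_mem_maximalIdeal _) (X_mul_X_pow_add_X_pow_mem 1 N)

theorem hypersurfaceEq_notMem {N : ℕ} (hN : N ≠ 0) :
    hypersurfaceEq N ∉ maximalIdeal PlaneSeries ^ (N + 3) := by
  intro h
  have h1 := le_order_of_mem_maximalIdeal_pow h
  have h2 : coeff (Finsupp.single 0 (N + 1) + Finsupp.single 1 1) (hypersurfaceEq N) = 1 := by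
    have h3 : hypersurfaceEq N = X 0 ^ (N + 1) * X 1 + X 1 ^ (N + 1) * X 0 := by
      rw [hypersurfaceEq]; ring
    have h4 : coeff (Finsupp.single 0 (N + 1) + Finsupp.single 1 1)
        (X 1 ^ (N + 1) * X 0 : PlaneSeries) = 0 :=
      X_pow_dvd_iff.1 (Dvd.intro _ rfl) _ (by simpa using Nat.pos_of_ne_zero hN)
    rw [h3, map_add, h4, X_pow_eq 0, coeff_add_monomial_mul]
    simp
  have h4 := order_le (f := hypersurfaceEq N)
    (d := Finsupp.single 0 (N + 1) + Finsupp.single 1 1) (by rw [h2]; exact one_ne_zero)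
  have h5 := h1.trans h4
  rw [map_add, Finsupp.degree_single, Finsupp.degree_single, Nat.cast_le] at h5
  omega

/-! ### No parameter generates an ideal containing `𝔪 ^ (N + 2)` -/

/-- If `(z, f)` contains a power of the maximal ideal, then `f` is a nonzerodivisor modulo `z`:
`f c ∈ (z)` gives `x ^ e c, y ^ e c ∈ (z)`, and `x ^ e, y ^ e` is a regular sequence. -/
theorem dvd_of_dvd_mul_of_maximalIdeal_pow_le {z f c : PlaneSeries} {e : ℕ}
    (hz : z ≠ 0) (hle : maximalIdeal PlaneSeries ^ e ≤ Ideal.span {z, f}) (h : z ∣ f * c) :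
    z ∣ c := by
  have key (i : Fin 2) : ∃ a, X i ^ e * c = z * a := by
    obtain ⟨p, q, hpq⟩ := Ideal.mem_span_pair.1
      (hle (Ideal.pow_mem_pow (X_mem_maximalIdeal i) e))
    obtain ⟨d, hd⟩ := h
    exact ⟨p * c + q * d, by linear_combination (-c) * hpq + q * hd⟩
  obtain ⟨a, ha⟩ := key 0
  obtain ⟨b, hb⟩ := key 1
  have hab : X 1 ^ e * a = X 0 ^ e * b := by
    apply mul_left_cancel₀ hz
    linear_combination X 0 ^ e * hb - X 1 ^ e * ha
  obtain ⟨a', rfl⟩ := X_pow_dvd_of_X_pow_mul_eq (by decide) hab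
  refine ⟨a', mul_left_cancel₀ (pow_ne_zero e (X_ne_zero (A := ZMod 2) (0 : Fin 2))) ?_⟩
  linear_combination ha

/-- Cancellation: for `v` in the maximal ideal `𝔫`, `v g ∈ 𝔫 ^ (e + 1)` is a multiple of `l g` modulo
`z`, and `g` is a nonzerodivisor modulo `z`. -/
theorem maximalIdeal_le_span_pair_of_pow_succ_le {l g z : PlaneSeries} {e : ℕ} (hz : z ≠ 0)
    (hg : g ∈ maximalIdeal PlaneSeries ^ e)
    (hle : maximalIdeal PlaneSeries ^ (e + 1) ≤ Ideal.span {z, l * g}) :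
    maximalIdeal PlaneSeries ≤ Ideal.span {l, z} := by
  intro v hv
  have hvg : v * g ∈ maximalIdeal PlaneSeries ^ (e + 1) := by
    rw [pow_succ']
    exact Ideal.mul_mem_mul hv hg
  obtain ⟨p, q, hpq⟩ := Ideal.mem_span_pair.1 (hle hvg)
  obtain ⟨c, hc⟩ : z ∣ v - q * l := by
    refine dvd_of_dvd_mul_of_maximalIdeal_pow_le hz hle ⟨p * l, ?_⟩
    linear_combination (-l) * hpq
  exact Ideal.mem_span_pair.2 ⟨q, c, by linear_combination -hc⟩

/-- Each of the three linear forms `l` over `𝔽₂` divides `f = xy(x ^ N + y ^ N)`, so the inclusion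
would give `(x, y) = (l, z)` for `l = x, y, x + y`. The linear part of `z` would then be a fourth
nonzero linear form over `𝔽₂`, and there are only three. -/
theorem not_maximalIdeal_pow_le_span_pair {N : ℕ} (hN : N ≠ 0) {z : PlaneSeries}
    (hz : z ∈ maximalIdeal PlaneSeries) :
    ¬ maximalIdeal PlaneSeries ^ (N + 2) ≤ Ideal.span {z, hypersurfaceEq N} := by
  intro hle
  have hz0 : z ≠ 0 := by
    rintro rfl
    have h0 : (X 0 : PlaneSeries) ^ (N + 2) ∈ Ideal.span {0, hypersurfaceEq N} :=
      hle (Ideal.pow_mem_pow (X_mem_maximalIdeal _) _)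
    obtain ⟨p, q, hpq⟩ := Ideal.mem_span_pair.1 h0
    have h1 : (X 0 : PlaneSeries) ^ (N + 2) * 1 =
        X 1 ^ 1 * (q * (X 0 * (X 0 ^ N + X 1 ^ N))) := by
      rw [hypersurfaceEq_eq_X_one_mul] at hpq
      linear_combination -hpq
    have h2 := isUnit_of_dvd_one (X_pow_dvd_of_X_pow_mul_eq (by decide) h1)
    rw [pow_one] at h2
    exact (mem_maximalIdeal _).1 (X_mem_maximalIdeal 1) h2
  have hz1 := mem_maximalIdeal_iff.1 hz
  -- As `l` and `z` have no constant term, only the constant terms `s`, `t` of the multipliers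
  -- contribute to the linear part of an element of `(l, z)`.
  have lin (l v : PlaneSeries) (hl : l ∈ maximalIdeal PlaneSeries)
      (hv : v ∈ Ideal.span {l, z}) : ∃ s t : ZMod 2, ∀ i : Fin 2,
        coeff (Finsupp.single i 1) v = s * coeff (Finsupp.single i 1) l +
          t * coeff (Finsupp.single i 1) z := by
    obtain ⟨p, q, rfl⟩ := Ideal.mem_span_pair.1 hv
    refine ⟨constantCoeff p, constantCoeff q, fun i => ?_⟩
    rw [map_add, coeff_single_one_mul, coeff_single_one_mul, mem_maximalIdeal_iff.1 hl, hz1]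
    ring
  have key (l g : PlaneSeries) (hl : l ∈ maximalIdeal PlaneSeries)
      (hg : g ∈ maximalIdeal PlaneSeries ^ (N + 1)) (hf : hypersurfaceEq N = l * g)
      (j : Fin 2) := lin l (X j) hl
        (maximalIdeal_le_span_pair_of_pow_succ_le hz0 hg (hf ▸ hle) (X_mem_maximalIdeal j))
  obtain ⟨g, hg, hfg⟩ := exists_hypersurfaceEq_eq_X_add_X_mul hN
  obtain ⟨s₁, t₁, h₁⟩ := key (X 0) _ (X_mem_maximalIdeal 0) (X_mul_X_pow_add_X_pow_mem 1 N)
    (hypersurfaceEq_eq_X_zero_mul N) 1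
  obtain ⟨s₂, t₂, h₂⟩ := key (X 1) _ (X_mem_maximalIdeal 1) (X_mul_X_pow_add_X_pow_mem 0 N)
    (hypersurfaceEq_eq_X_one_mul N) 0
  obtain ⟨s₃, t₃, h₃⟩ := key (X 0 + X 1) g
    (Ideal.add_mem _ (X_mem_maximalIdeal 0) (X_mem_maximalIdeal 1)) hg hfg 0
  have e₁ := h₁ 1
  have e₂ := h₂ 0
  have e₃ := h₃ 0
  have e₄ := h₃ 1
  simp [coeff_X, Finsupp.single_left_inj] at e₁ e₂ e₃ e₄
  generalize coeff (Finsupp.single 0 1) z = c₀ at *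
  generalize coeff (Finsupp.single 1 1) z = c₁ at *
  -- The remaining statement concerns finitely many elements of `𝔽₂`.
  clear * - e₁ e₂ e₃ e₄
  revert t₁ c₁ t₂ c₀ s₃ t₃
  decide

/-! ### Powers of `(x, y)` modulo `x ^ 2 + x y + y ^ 2` -/

/-- Modulo `x ^ 2 + x y + y ^ 2` every monomial reduces to degree at most one in `x`. -/
theorem span_pair_pow_le {A : Type*} [CommRing A] (x y : A) (k : ℕ) :
    Ideal.span {x, y} ^ (k + 1) ≤
      Ideal.span {x * y ^ k, y ^ (k + 1), x ^ 2 + x * y + y ^ 2} := by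
  induction k with
  | zero =>
    rw [zero_add, pow_one, Ideal.span_le]
    rintro _ (rfl | rfl)
    · exact Ideal.subset_span (by simp)
    · exact Ideal.subset_span (by simp)
  | succ k ih =>
    rw [pow_succ']
    refine (Ideal.mul_mono_right ih).trans ?_
    rw [Ideal.span_mul_span', Ideal.span_le]
    have h1 : x * y ^ (k + 1) ∈
        Ideal.span {x * y ^ (k + 1), y ^ (k + 1 + 1), x ^ 2 + x * y + y ^ 2} :=
      Ideal.subset_span (by simp)
    have h2 : y ^ (k + 1 + 1) ∈
        Ideal.span {x * y ^ (k + 1), y ^ (k + 1 + 1), x ^ 2 + x * y + y ^ 2} :=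
      Ideal.subset_span (by simp)
    have h3 : x ^ 2 + x * y + y ^ 2 ∈
        Ideal.span {x * y ^ (k + 1), y ^ (k + 1 + 1), x ^ 2 + x * y + y ^ 2} :=
      Ideal.subset_span (by simp)
    rintro _ ⟨_, rfl | rfl, _, rfl | rfl | rfl, rfl⟩
    · have := Ideal.sub_mem _ (Ideal.sub_mem _ (Ideal.mul_mem_left _ (y ^ k) h3) h1) h2
      rw [SetLike.mem_coe]
      convert this using 1
      ring
    · exact h1
    · exact Ideal.mul_mem_left _ _ h3
    · rw [SetLike.mem_coe]
      convert h1 using 1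
      ring
    · rw [SetLike.mem_coe]
      convert h2 using 1
      ring
    · exact Ideal.mul_mem_left _ _ h3

/-- Modulo `x ^ 2 + x y + y ^ 2` one has `x ^ 3 = y ^ 3`, so that `xy(x ^ N + y ^ N)` depends only on
`N` modulo `3` up to powers of `y`: up to sign it becomes `y ^ (N + 2)` if `N ≡ 1` and
`y ^ (N + 1) (x + y)` if `N ≡ 2`. (If `3 ∣ N` it becomes `2 x y ^ (N + 1)`, which is zero over
`𝔽₂`.) -/
theorem mul_pow_eq_zero_and_pow_eq_zero {A : Type*} [CommRing A] {x y : A}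
    {N : ℕ} (hN : ¬ 3 ∣ N) (hu : x ^ 2 + x * y + y ^ 2 = 0)
    (hf : x * y * (x ^ N + y ^ N) = 0) : x * y ^ (N + 2) = 0 ∧ y ^ (N + 3) = 0 := by
  have h3 : x ^ 3 = y ^ 3 := by linear_combination (x - y) * hu
  have hq (q : ℕ) : x ^ (3 * q) = y ^ (3 * q) := by rw [pow_mul, h3, ← pow_mul]
  have hN' : N = 3 * (N / 3) + 1 ∨ N = 3 * (N / 3) + 2 := by omega
  generalize N / 3 = q at hN'
  rcases hN' with rfl | rfl
  · have h4 : y ^ (3 * q + 3) = 0 := by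
      rw [pow_succ, hq] at hf
      linear_combination (-1 : A) * hf + y ^ (3 * q) * y * hu
    exact ⟨by linear_combination x * h4, by linear_combination y * h4⟩
  · have h4 : y ^ (3 * q + 3) * (x + y) = 0 := by
      rw [pow_add, hq] at hf
      linear_combination hf - y ^ (3 * q) * y * h3
    have h5 : y ^ (3 * q + 5) = 0 := by
      linear_combination (-x) * h4 + y ^ (3 * q + 3) * hu
    exact ⟨by linear_combination y * h4 - h5, h5⟩

end Hypersurface

/-! ### The hypersurface ring: dimension and generalized Loewy length -/

section Ring

open MvPowerSeries IsLocalRing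

variable {N : ℕ}

theorem maximalIdeal_hypersurfaceRing :
    maximalIdeal (HypersurfaceRing N) =
      (maximalIdeal PlaneSeries).map (Ideal.Quotient.mk (Ideal.span {hypersurfaceEq N})) :=
  (map_maximalIdeal_of_surjective _ Ideal.Quotient.mk_surjective).symm

theorem maximalIdeal_hypersurfaceRing_eq_span :
    maximalIdeal (HypersurfaceRing N) = Ideal.span {xbar N, ybar N} := by
  rw [maximalIdeal_hypersurfaceRing, maximalIdeal_eq_span_X, Ideal.map_span, Set.image_pair]
  rfl

theorem xbar_mem : xbar N ∈ maximalIdeal (HypersurfaceRing N) := by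
  rw [maximalIdeal_hypersurfaceRing_eq_span]
  exact Ideal.subset_span (by simp)

theorem ybar_mem : ybar N ∈ maximalIdeal (HypersurfaceRing N) := by
  rw [maximalIdeal_hypersurfaceRing_eq_span]
  exact Ideal.subset_span (by simp)

theorem maximalIdeal_pow_le_span_quadratic (hN : ¬ 3 ∣ N) :
    maximalIdeal (HypersurfaceRing N) ^ (N + 3) ≤
      Ideal.span {xbar N ^ 2 + xbar N * ybar N + ybar N ^ 2} := by
  rw [maximalIdeal_hypersurfaceRing_eq_span]
  refine (span_pair_pow_le _ _ _).trans ?_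
  rw [Ideal.span_le]
  have hf : xbar N * ybar N * (xbar N ^ N + ybar N ^ N) = 0 :=
    Ideal.Quotient.eq_zero_iff_mem.2 (Ideal.mem_span_singleton_self (hypersurfaceEq N))
  have h := mul_pow_eq_zero_and_pow_eq_zero
    (x := Ideal.Quotient.mk (Ideal.span {xbar N ^ 2 + xbar N * ybar N + ybar N ^ 2}) (xbar N))
    (y := Ideal.Quotient.mk (Ideal.span {xbar N ^ 2 + xbar N * ybar N + ybar N ^ 2}) (ybar N)) hN
    (Ideal.Quotient.eq_zero_iff_mem.2 (Ideal.mem_span_singleton_self _))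
    (by rw [← map_pow, ← map_pow, ← map_add, ← map_mul, ← map_mul, hf, map_zero])
  rintro _ (rfl | rfl | rfl)
  · exact Ideal.Quotient.eq_zero_iff_mem.1 h.1
  · exact Ideal.Quotient.eq_zero_iff_mem.1 h.2
  · exact Ideal.mem_span_singleton_self _

theorem quadratic_mem :
    xbar N ^ 2 + xbar N * ybar N + ybar N ^ 2 ∈ maximalIdeal (HypersurfaceRing N) :=
  Ideal.add_mem _ (Ideal.add_mem _ (Ideal.pow_mem_of_mem _ xbar_mem 2 two_pos)
    (Ideal.mul_mem_right _ _ xbar_mem)) (Ideal.pow_mem_of_mem _ ybar_mem 2 two_pos)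

theorem radical_span_quadratic (hN : ¬ 3 ∣ N) :
    (Ideal.span {xbar N ^ 2 + xbar N * ybar N + ybar N ^ 2}).radical =
      maximalIdeal (HypersurfaceRing N) := by
  apply le_antisymm
  · exact (Ideal.radical_mono ((Ideal.span_singleton_le_iff_mem _).2 quadratic_mem)).trans
      (Ideal.IsPrime.radical inferInstance).le
  · intro a ha
    exact ⟨N + 3, maximalIdeal_pow_le_span_quadratic hN (Ideal.pow_mem_pow ha _)⟩

theorem ybar_not_isNilpotent : ¬ IsNilpotent (ybar N) := by
  rintro ⟨k, hk⟩
  obtain ⟨c, hc⟩ := Ideal.mem_span_singleton.1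
    (Ideal.Quotient.eq_zero_iff_mem.1
      (show Ideal.Quotient.mk (Ideal.span {hypersurfaceEq N}) (X 1 ^ k) = 0 from hk))
  have h1 : (X 1 : PlaneSeries) ^ k * 1 = X 0 ^ 1 * (X 1 * (X 0 ^ N + X 1 ^ N) * c) := by
    rw [mul_one, hc, hypersurfaceEq_eq_X_zero_mul]
    ring
  have h2 := isUnit_of_dvd_one (X_pow_dvd_of_X_pow_mul_eq (by decide) h1)
  rw [pow_one] at h2
  exact (mem_maximalIdeal _).1 (X_mem_maximalIdeal 0) h2

theorem ringKrullDim_hypersurfaceRing (hN : ¬ 3 ∣ N) : ringKrullDim (HypersurfaceRing N) = 1 := by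
  apply le_antisymm
  · rw [← maximalIdeal_height_eq_ringKrullDim]
    have h : maximalIdeal (HypersurfaceRing N) ∈
        (Ideal.span {xbar N ^ 2 + xbar N * ybar N + ybar N ^ 2}).minimalPrimes := by
      refine ⟨⟨inferInstance, (Ideal.span_singleton_le_iff_mem _).2 quadratic_mem⟩,
        fun p hp _ => ?_⟩
      rw [← radical_span_quadratic hN]
      exact (Ideal.radical_mono hp.2).trans hp.1.radical.le
    exact_mod_cast Ideal.height_le_one_of_isPrincipal_of_mem_minimalPrimes _ _ h
  · -- In dimension zero all elements of the maximal ideal are nilpotent, but `y` is not.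
    by_contra hlt
    have h0 : Ring.KrullDimLE 0 (HypersurfaceRing N) := by
      rw [Ring.krullDimLE_iff]
      exact Order.le_of_lt_succ (not_le.1 hlt)
    refine ybar_not_isNilpotent (N := N) ?_
    have h := (Ring.krullDimLE_zero_and_isLocalRing_tfae (HypersurfaceRing N)).out 0 2
    exact (h.1 ⟨h0, inferInstance⟩ _).2 ((mem_maximalIdeal _).1 ybar_mem)

/-- Since the defining equation has order `N + 2`, passing to the quotient does not affect the powers
`𝔪 ^ k` with `k ≤ N + 2`. -/
theorem mk_mem_maximalIdeal_pow_iff {k : ℕ} (hk : k ≤ N + 2) {a : PlaneSeries} :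
    Ideal.Quotient.mk (Ideal.span {hypersurfaceEq N}) a ∈ maximalIdeal (HypersurfaceRing N) ^ k ↔
      a ∈ maximalIdeal PlaneSeries ^ k := by
  rw [maximalIdeal_hypersurfaceRing, ← Ideal.map_pow]
  refine ⟨fun h => ?_, Ideal.mem_map_of_mem _⟩
  obtain ⟨b, hb, hba⟩ := (Ideal.mem_map_iff_of_surjective _ Ideal.Quotient.mk_surjective).1 h
  have h1 : Ideal.span {hypersurfaceEq N} ≤ maximalIdeal PlaneSeries ^ k :=
    (Ideal.span_singleton_le_iff_mem _).2 (Ideal.pow_le_pow_right hk (hypersurfaceEq_mem N))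
  have h2 := Ideal.sub_mem _ hb (h1 (Ideal.Quotient.eq.1 hba))
  rwa [sub_sub_cancel] at h2

theorem gll_hypersurfaceRing (hN : ¬ 3 ∣ N) : gll (HypersurfaceRing N) = (N + 3 : ℕ) := by
  have hN0 : N ≠ 0 := by rintro rfl; exact hN (dvd_zero 3)
  apply le_antisymm
  · refine sInf_le ⟨N + 3, rfl, by omega, 1,
      fun _ => xbar N ^ 2 + xbar N * ybar N + ybar N ^ 2, ⟨?_, ?_⟩, ?_⟩
    · rw [ringKrullDim_hypersurfaceRing hN]; rfl
    · rw [Set.range_const]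
      exact radical_span_quadratic hN
    · rw [Set.range_const]
      exact maximalIdeal_pow_le_span_quadratic hN
  · refine le_sInf ?_
    rintro _ ⟨n, rfl, hn, d, x, ⟨hd, hrad⟩, hle⟩
    rw [Nat.cast_le]
    by_contra hlt
    rw [ringKrullDim_hypersurfaceRing hN] at hd
    obtain rfl : d = 1 := by exact_mod_cast hd.symm
    obtain ⟨z, hz⟩ := Ideal.Quotient.mk_surjective (x 0)
    have hx : Set.range x = {Ideal.Quotient.mk _ z} := by
      rw [Set.range_unique, hz]
      rfl
    rw [hx] at hrad hle
    have hzm : z ∈ maximalIdeal PlaneSeries := by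
      have h1 := hrad ▸ Ideal.le_radical (Ideal.mem_span_singleton_self (Ideal.Quotient.mk _ z))
      rw [← pow_one (maximalIdeal PlaneSeries), ← mk_mem_maximalIdeal_pow_iff (N := N) (by omega),
        pow_one]
      exact h1
    refine not_maximalIdeal_pow_le_span_pair hN0 hzm fun a ha => ?_
    have h2 := hle (Ideal.pow_le_pow_right (show n ≤ N + 2 by omega)
      ((mk_mem_maximalIdeal_pow_iff le_rfl).2 ha))
    obtain ⟨c, hc⟩ := Ideal.mem_span_singleton'.1 h2
    obtain ⟨c, rfl⟩ := Ideal.Quotient.mk_surjective c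
    rw [← map_mul] at hc
    obtain ⟨q, hq⟩ := Ideal.mem_span_singleton'.1 (Ideal.Quotient.eq.1 hc)
    exact Ideal.mem_span_pair.2 ⟨c, -q, by linear_combination -hq⟩

end Ring

/-! ### The `δ`-invariant and the index -/

section Delta

open IsLocalRing

/-- The projection `R → R ⧸ I` shows `δ(R ⧸ I) ≤ 1`, so only the value zero has to be excluded. -/
theorem delta_quotient_eq_one.{w} {R : Type w} [CommRing R] [IsLocalRing R] {I : Ideal R}
    (h : ∀ (X : Type w) [AddCommGroup X] [Module R X], (Subsingleton X ∨ IsMaximalCM R X) →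
      NoFreeSummand R X → ∀ φ : X →ₗ[R] R ⧸ I, ¬ Function.Surjective φ) :
    delta R (R ⧸ I) = 1 := by
  have h1 : 1 ∈ {n : ℕ | ∃ (X : Type w) (_ : AddCommGroup X) (_ : Module R X),
      (Subsingleton X ∨ IsMaximalCM R X) ∧ NoFreeSummand R X ∧
      ∃ φ : (X × (Fin n → R)) →ₗ[R] R ⧸ I, Function.Surjective φ} := by
    refine ⟨PUnit, inferInstance, inferInstance, Or.inl inferInstance,
      fun M P _ _ => Subsingleton.elim _ _,
      Submodule.mkQ I ∘ₗ LinearMap.proj 0 ∘ₗ LinearMap.snd _ _ _, fun c => ?_⟩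
    obtain ⟨c, rfl⟩ := Submodule.mkQ_surjective _ c
    exact ⟨(0, fun _ => c), rfl⟩
  refine le_antisymm (Nat.sInf_le h1) (le_csInf ⟨1, h1⟩ ?_)
  rintro n ⟨X, _, _, hX, hfree, φ, hφ⟩
  by_contra hn
  obtain rfl : n = 0 := by omega
  refine h X hX hfree (φ ∘ₗ LinearMap.inl _ _ _) fun c => ?_
  obtain ⟨⟨ξ, v⟩, rfl⟩ := hφ c
  exact ⟨ξ, by rw [LinearMap.comp_apply, LinearMap.inl_apply, Subsingleton.elim v 0]⟩

theorem delta_eq_zero_of_surjective.{w, w'} {R : Type w} [CommRing R] [IsLocalRing R]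
    {M : Type w'} [AddCommGroup M] [Module R M] {X : Type w} [AddCommGroup X] [Module R X]
    (hX : IsMaximalCM R X) (hfree : NoFreeSummand R X) (φ : X →ₗ[R] M)
    (hφ : Function.Surjective φ) : delta R M = 0 :=
  Nat.sInf_eq_zero.2 (Or.inl ⟨X, inferInstance, inferInstance, Or.inr hX, hfree,
    φ ∘ₗ LinearMap.fst _ _ _, hφ.comp Prod.fst_surjective⟩)

theorem noFreeSummand_of_smul_eq_zero {R X : Type*} [CommRing R] [IsLocalRing R] [AddCommGroup X]
    [Module R X] {r : R} (hr : r ≠ 0) (h : ∀ ξ : X, r • ξ = 0) : NoFreeSummand R X := by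
  intro M P _ hM
  by_contra hne
  have : Nontrivial M := Submodule.nontrivial_iff_ne_bot.2 hne
  refine hr (FaithfulSMul.eq_of_smul_eq_smul (α := M) fun ξ => ?_)
  rw [zero_smul]
  exact Subtype.ext (h ξ)

/-- Over a one-dimensional local ring, a maximal Cohen-Macaulay module has zero socle. -/
theorem eq_zero_of_smul_eq_zero_of_isMaximalCM {R X : Type*} [CommRing R] [IsLocalRing R]
    [AddCommGroup X] [Module R X] (hdim : ringKrullDim R = 1) (hX : IsMaximalCM R X) {x y : R}
    (hm : maximalIdeal R = Ideal.span {x, y}) {ξ : X} (hx : x • ξ = 0) (hy : y • ξ = 0) :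
    ξ = 0 := by
  obtain ⟨-, rs, hlen, hmem, hreg⟩ := hX
  rw [hdim] at hlen
  obtain ⟨r, rfl⟩ := List.length_eq_one_iff.1 (show rs.length = 1 by exact_mod_cast hlen.symm)
  obtain ⟨p, q, hpq⟩ := Ideal.mem_span_pair.1 (hm ▸ hmem r (by simp))
  refine ((RingTheory.Sequence.isRegular_cons_iff X r []).1 hreg).1 ?_
  change r • ξ = r • 0
  rw [← hpq, add_smul, mul_smul, mul_smul, hx, hy]
  simp

variable {N : ℕ}

open MvPowerSeries in
/-- The module `R ⧸ (g)` with `g = y(x ^ N + y ^ N)`, isomorphic to the ideal `x R`, is maximal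
Cohen-Macaulay: `x` is regular on it because `x` is prime and does not divide `g`. -/
theorem isMaximalCM_quotient_cofactor (hN : ¬ 3 ∣ N) :
    IsMaximalCM (HypersurfaceRing N)
      (HypersurfaceRing N ⧸ Ideal.span {ybar N * (xbar N ^ N + ybar N ^ N)}) := by
  have hN0 : N ≠ 0 := by rintro rfl; exact hN (dvd_zero 3)
  refine ⟨inferInstance, [xbar N], by rw [ringKrullDim_hypersurfaceRing hN]; rfl, ?_, ?_⟩
  · intro r hr
    rw [List.mem_singleton.1 hr]
    exact xbar_mem
  · have hnt : Nontrivial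
        (HypersurfaceRing N ⧸ Ideal.span {ybar N * (xbar N ^ N + ybar N ^ N)}) := by
      rw [Ideal.Quotient.nontrivial_iff, Ne, Ideal.span_singleton_eq_top]
      exact (mem_maximalIdeal _).1 (Ideal.mul_mem_right _ _ ybar_mem)
    refine RingTheory.Sequence.IsRegular.of_isWeaklyRegular_of_mem_maximalIdeal _ ?_ ?_
    · intro r hr
      rw [List.mem_singleton.1 hr]
      exact xbar_mem
    refine RingTheory.Sequence.IsWeaklyRegular.cons ?_ (RingTheory.Sequence.IsWeaklyRegular.nil _ _)
    rw [isSMulRegular_iff_right_eq_zero_of_smul]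
    intro c hc
    obtain ⟨c, rfl⟩ := Ideal.Quotient.mk_surjective c
    obtain ⟨a, rfl⟩ := Ideal.Quotient.mk_surjective c
    obtain ⟨b, hb⟩ := Ideal.mem_span_singleton'.1
      (Ideal.Quotient.eq_zero_iff_mem.1 (show Ideal.Quotient.mk _ (xbar N * _) = 0 from hc))
    obtain ⟨b, rfl⟩ := Ideal.Quotient.mk_surjective b
    obtain ⟨d, hd⟩ := Ideal.mem_span_singleton'.1 (Ideal.Quotient.eq.1
      (show Ideal.Quotient.mk (Ideal.span {hypersurfaceEq N}) (b * (X 1 * (X 0 ^ N + X 1 ^ N))) =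
        Ideal.Quotient.mk (Ideal.span {hypersurfaceEq N}) (X 0 * a) from hb))
    rw [hypersurfaceEq_eq_X_zero_mul] at hd
    obtain ⟨M, rfl⟩ := Nat.exists_eq_succ_of_ne_zero hN0
    -- Modulo `x`, `g` is `y ^ (N + 1)`; hence `x` divides `b`.
    have h1 : X 1 ^ (M + 2) * b =
        X 0 ^ 1 * (a + X 1 * (X 0 ^ (M + 1) + X 1 ^ (M + 1)) * d - X 1 * X 0 ^ M * b) := by
      rw [Nat.succ_eq_add_one] at hd
      linear_combination -hd
    obtain ⟨b', rfl⟩ := X_pow_dvd_of_X_pow_mul_eq (by decide) h1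
    have h2 : a = (b' - d) * (X 1 * (X 0 ^ (M + 1) + X 1 ^ (M + 1))) := by
      apply mul_left_cancel₀ (X_ne_zero (A := ZMod 2) (0 : Fin 2))
      rw [Nat.succ_eq_add_one] at hd
      linear_combination hd
    rw [Ideal.Quotient.eq_zero_iff_mem, h2]
    exact Ideal.mem_span_singleton'.2 ⟨Ideal.Quotient.mk _ (b' - d), rfl⟩

open MvPowerSeries in
theorem cofactor_ne_zero (hN : N ≠ 0) : ybar N * (xbar N ^ N + ybar N ^ N) ≠ 0 := by
  intro h
  obtain ⟨c, hc⟩ := Ideal.mem_span_singleton'.1 (Ideal.Quotient.eq_zero_iff_mem.1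
    (show Ideal.Quotient.mk (Ideal.span {hypersurfaceEq N}) (X 1 * (X 0 ^ N + X 1 ^ N)) = 0 from h))
  refine hypersurfaceEq_notMem hN ?_
  have h1 : hypersurfaceEq N = (X 0 * X 0 * c) * (X 1 * (X 0 ^ N + X 1 ^ N)) := by
    conv_lhs => rw [hypersurfaceEq_eq_X_zero_mul, ← hc, hypersurfaceEq_eq_X_zero_mul]
    ring
  rw [h1, show N + 3 = 2 + (N + 1) by omega, pow_add]
  refine Ideal.mul_mem_mul (Ideal.mul_mem_right _ _ ?_) (X_mul_X_pow_add_X_pow_mem 1 N)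
  rw [pow_two]
  exact Ideal.mul_mem_mul (X_mem_maximalIdeal _) (X_mem_maximalIdeal _)

/-- The module `R ⧸ (g)`, `g = y(x ^ N + y ^ N) ∈ 𝔪 ^ (N + 1)`, maps onto `R ⧸ 𝔪 ^ k`. -/
theorem delta_hypersurfaceRing_eq_zero (hN : ¬ 3 ∣ N) {k : ℕ} (hk : k ≤ N + 1) :
    delta (HypersurfaceRing N)
      (HypersurfaceRing N ⧸ maximalIdeal (HypersurfaceRing N) ^ k) = 0 := by
  have hN0 : N ≠ 0 := by rintro rfl; exact hN (dvd_zero 3)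
  have hle : Ideal.span {ybar N * (xbar N ^ N + ybar N ^ N)} ≤
      maximalIdeal (HypersurfaceRing N) ^ k := by
    rw [Ideal.span_singleton_le_iff_mem]
    refine Ideal.pow_le_pow_right hk ?_
    rw [pow_succ']
    exact Ideal.mul_mem_mul ybar_mem
      (Ideal.add_mem _ (Ideal.pow_mem_pow xbar_mem N) (Ideal.pow_mem_pow ybar_mem N))
  refine delta_eq_zero_of_surjective (isMaximalCM_quotient_cofactor hN)
    (noFreeSummand_of_smul_eq_zero (cofactor_ne_zero hN0) fun c => ?_) (Submodule.factor hle)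
    (Submodule.factor_surjective hle)
  obtain ⟨c, rfl⟩ := Ideal.Quotient.mk_surjective c
  exact Ideal.Quotient.eq_zero_iff_mem.2
    (Ideal.mul_mem_right c _ (Ideal.mem_span_singleton_self _))

theorem delta_hypersurfaceRing_eq_one (hN : ¬ 3 ∣ N) :
    delta (HypersurfaceRing N)
      (HypersurfaceRing N ⧸ maximalIdeal (HypersurfaceRing N) ^ (N + 2)) = 1 := by
  have hN0 : N ≠ 0 := by rintro rfl; exact hN (dvd_zero 3)
  refine delta_quotient_eq_one fun X _ _ hX hfree φ hφ => ?_
  rcases hX with hX | hX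
  · have hnt : Nontrivial
        (HypersurfaceRing N ⧸ maximalIdeal (HypersurfaceRing N) ^ (N + 2)) :=
      Ideal.Quotient.nontrivial_iff.2 fun h => (maximalIdeal.isMaximal _).ne_top
        (top_le_iff.1 (h ▸ Ideal.pow_le_self (by omega)))
    exact not_subsingleton _ hφ.subsingleton
  · have := hX.1
    let _ : Module PlaneSeries X :=
      Module.compHom X (Ideal.Quotient.mk (Ideal.span {hypersurfaceEq N}))
    have hsmul (a : PlaneSeries) (ξ : X) :
        a • ξ = (Ideal.Quotient.mk (Ideal.span {hypersurfaceEq N}) a) • ξ := rfl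
    have : IsScalarTower PlaneSeries (HypersurfaceRing N) X :=
      ⟨fun a c ξ => by rw [hsmul, ← mul_smul]; rfl⟩
    have : Module.Finite PlaneSeries X := Module.Finite.trans (HypersurfaceRing N) X
    -- `R ⧸ 𝔪 ^ (N + 2)` is `S ⧸ 𝔫 ^ (N + 2)` for `S = 𝔽₂⟦x, y⟧` with maximal ideal `𝔫`.
    let ψ : PlaneSeries →ₗ[PlaneSeries]
        HypersurfaceRing N ⧸ maximalIdeal (HypersurfaceRing N) ^ (N + 2) :=
      ((maximalIdeal (HypersurfaceRing N) ^ (N + 2)).mkQ.restrictScalars PlaneSeries) ∘ₗ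
        (Ideal.span {hypersurfaceEq N}).mkQ
    have hψ : Function.Surjective ψ :=
      (Submodule.mkQ_surjective _).comp (Submodule.mkQ_surjective _)
    have hker : LinearMap.ker ψ = maximalIdeal PlaneSeries ^ (N + 2) := by
      ext a
      rw [LinearMap.mem_ker, ← mk_mem_maximalIdeal_pow_iff (N := N) le_rfl]
      exact Ideal.Quotient.eq_zero_iff_mem
    let e := (Submodule.quotEquivOfEq _ _ hker).symm.trans (ψ.quotKerEquivOfSurjective hψ)
    refine hypersurfaceEq_notMem hN0 (mem_maximalIdeal_pow_succ_of_surjective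
      (X := X) maximalIdeal_eq_span_X exists_eq_mul_of_X_mul_add_X_mul_eq_zero ?_ hfree
      (show N + 2 ≠ 0 by omega) (e.symm.toLinearMap ∘ₗ φ.restrictScalars PlaneSeries)
      (e.symm.surjective.comp hφ))
    intro ξ hx hy
    exact eq_zero_of_smul_eq_zero_of_isMaximalCM (ringKrullDim_hypersurfaceRing hN) hX
      maximalIdeal_hypersurfaceRing_eq_span hx hy

theorem index_hypersurfaceRing (hN : ¬ 3 ∣ N) : index (HypersurfaceRing N) = (N + 2 : ℕ) := by
  apply le_antisymm
  · exact sInf_le ⟨N + 2, rfl, by omega, delta_hypersurfaceRing_eq_one hN⟩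
  · refine le_sInf ?_
    rintro _ ⟨k, rfl, -, hk⟩
    rw [Nat.cast_le]
    by_contra hlt
    rw [delta_hypersurfaceRing_eq_zero hN (by omega)] at hk
    exact zero_ne_one hk

end Delta
end LoewyIndex

theorem proposition3p12 (n m p : ℕ) (hp : p.Prime) (hp3 : 3 < p)
    (h2 : LoewyIndex.IsPrimitiveRootMod 2 (p ^ 2) ∨
      (m = 1 ∧ LoewyIndex.IsPrimitiveRootMod 2 p)) :
    LoewyIndex.gll (LoewyIndex.HypersurfaceRing (2 ^ n * p ^ m)) =
        LoewyIndex.index (LoewyIndex.HypersurfaceRing (2 ^ n * p ^ m)) + 1 ∧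
      LoewyIndex.index (LoewyIndex.HypersurfaceRing (2 ^ n * p ^ m)) + 1 =
        ((2 ^ n * p ^ m + 3 : ℕ) : ℕ∞) ∧
      IsLocalRing.maximalIdeal (LoewyIndex.HypersurfaceRing (2 ^ n * p ^ m)) ^
          (2 ^ n * p ^ m + 3) ≤
        Ideal.span {LoewyIndex.xbar (2 ^ n * p ^ m) ^ 2 +
          LoewyIndex.xbar (2 ^ n * p ^ m) * LoewyIndex.ybar (2 ^ n * p ^ m) +
          LoewyIndex.ybar (2 ^ n * p ^ m) ^ 2} := by
  have hN : ¬ 3 ∣ 2 ^ n * p ^ m := by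
    rw [Nat.prime_three.dvd_mul, not_or]
    constructor
    · intro h
      have := Nat.le_of_dvd two_pos (Nat.prime_three.dvd_of_dvd_pow h)
      omega
    · intro h
      have := (Nat.prime_dvd_prime_iff_eq Nat.prime_three hp).1 (Nat.prime_three.dvd_of_dvd_pow h)
      omega
  have hindex : LoewyIndex.index (LoewyIndex.HypersurfaceRing (2 ^ n * p ^ m)) + 1 =
      ((2 ^ n * p ^ m + 3 : ℕ) : ℕ∞) := by
    rw [LoewyIndex.index_hypersurfaceRing hN]
    rfl
  exact ⟨(LoewyIndex.gll_hypersurfaceRing hN).trans hindex.symm, hindex,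
    LoewyIndex.maximalIdeal_pow_le_span_quadratic hN⟩
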